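/- **Setting.** Let $\alpha\in[0,1]$ and write $E=L^2(\mathbb R)\cap L^\infty(\mathbb R)$. Consider the two-component Camassa–Holm system $u_t-u_{txx}+3uu_x-2u_xu_{xx}-uu_{xxx}+\rho\rho_x=0$, $\rho_t+(u\rho)_x=0$ on $\mathbb R$. *Eulerian coordinates.* $\mathcal D$ is the set of $(u,\rho,\mu,\nu)$ with $u\in H^1(\mathbb R)$, $\rho\in L^2(\mathbb R)$, and $\mu\le\nu$ finite positive Borel measures on $\mathbb R$ with $\mu_{\rm ac}=(u_x^2+\rho^2)\,dx$. Here ac and s denote the absolutely continuous and singular parts with respect to Lebesgue measure. *Lagrangian coordinates.* $\mathcal G$ is the set of $\Theta=(y,U,y_\xi,U_\xi,\bar h,h,r)$, functions of $\xi\in\mathbb R$, with $\zeta=y-\mathrm{id}\in L^\infty$; $U,\zeta_\xi,U_\xi,h,r\in E$; $g(\Theta)-1\in E$; $h\in L^1$; $y_\xi\ge0$ and $0\le\bar h\le h$ a.e.; $\zeta(\xi)\to0$ as $\xi\to-\infty$; $1/(y_\xi+h)\in L^\infty$; and $y_\xi\bar h=U_\xi^2+r^2$ a.e. Here $g(\Theta)=\alpha(|U_\xi|+2y_\xi)+(1-\alpha)(y_\xi+\bar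 h)$ where $|U_\xi|+2y_\xi\le y_\xi+\bar h$, $U_\xi\le0$ and $r=0$, and $g(\Theta)=y_\xi+\bar h$ elsewhere. *Lagrangian solutions.* A global $\alpha$-dissipative solution in Lagrangian coordinates is a map $t\mapsto\Theta(t)\in\mathcal G$, $t\ge0$, such that for every $T>0$: $y-\mathrm{id}\in L^\infty([0,T],W^{1,\infty})$; $U\in L^\infty([0,T],H^1)$; $y_\xi-1,U_\xi,r$ are bounded and Lipschitz in $t\in[0,T]$ with values in $E$; $\bar h\in L^\infty([0,T],L^2)$; $h$ is bounded and Lipschitz in $t\in[0,T]$ with values in $L^1\cap L^\infty$; and such that the following holds. Put $\tau_0(\xi)=0$, let $\tau_n(\xi)$ be the time $t>\tau_{n-1}(\xi)$ with $y_\xi(t,\xi)=0$ and $y_\xi(\cdot,\xi)>0$ on $(\tau_{n-1}(\xi),t)$, and $\tau_n(\xi)=\infty$ if there is none. The $\tau_n$ are measurable and, for a.e. $\xi$, $\tau_n(\xi)\to\infty$ (possibly $\tau_n(\xi)=\infty$ from some $n$ on). For a.e. $\xi$, the equations $$y_t=U,\quad U_t=-Q,\quad (y_\xi)_t=U_\xi,\quad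 (U_\xi)_t=\tfrac12\bar h+(U^2-P)y_\xi,\quad h_t=2(U^2-P)U_\xi,\quad r_t=0$$ hold in integrated form on $[0,\infty)$ (so these six components are continuous in $t$), $\bar h-h$ is constant in $t$ on each $[\tau_{n-1}(\xi),\tau_n(\xi))$, and $\bar h(\tau_n(\xi),\xi)=(1-\alpha)\lim_{t\uparrow\tau_n(\xi)}\bar h(t,\xi)$ for each $n\ge1$ with $\tau_n(\xi)<\infty$. Here $$P(t,\xi)=\tfrac14\int_{\mathbb R}e^{-|y(t,\xi)-y(t,\eta)|}(2U^2y_\xi+\bar h)(t,\eta)\,d\eta,$$ $$Q(t,\xi)=-\tfrac14\int_{\mathbb R}\operatorname{sgn}(\xi-\eta)e^{-|y(t,\xi)-y(t,\eta)|}(2U^2y_\xi+\bar h)(t,\eta)\,d\eta.$$ *$\alpha$-dissipative solutions.* Given $(u_0,\rho_0,\mu_0,\nu_0)\in\mathcal D$, write $\mu_0=f\nu_0$ and let $L(u_0,\rho_0,\mu_0,\nu_0)$ be given by $y(\xi)=\sup\{x\mid\nu_0((-\infty,x))+x<\xi\}$, $h=1-y_\xi$, $U=u_0\circ y$, $r=(\rho_0\circ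 y)\,y_\xi$, $\bar h=(f\circ y)\,h$. The $\alpha$-dissipative solution with these initial data is $(u,\rho,\mu,\nu)(t)$, $t\ge0$, obtained from a global $\alpha$-dissipative Lagrangian solution with $\Theta(0)=L(u_0,\rho_0,\mu_0,\nu_0)$ by $u(t,y(t,\xi))=U(t,\xi)$ for all $\xi$, $\mu(t)=y(t)_\#(\bar h(t)\,d\xi)$, $\nu(t)=y(t)_\#(h(t)\,d\xi)$, $\rho(t)\,dx=y(t)_\#(r(t)\,d\xi)$. **Theorem.** Let $(u,\rho,\mu,\nu)$ be an $\alpha$-dissipative solution of the two-component Camassa–Holm system with initial data in $\mathcal D$. Then $\mu(t)$ is a finite measure for all $t\ge0$, and the weak-$*$ limits (tested against continuous functions with compact support) $$\mu^-(t)=\lim_{t'\uparrow t}\mu(t')\quad(t>0),\qquad \mu^+(t)=\lim_{t'\downarrow t}\mu(t')\quad(t\ge0)$$ exist as finite measures. For all $t\ge0$, $\mu^+(t)=\mu(t)$. For all $t>0$, $$\mu(t)=\mu^-_{\rm ac}(t)+(1-\alpha)\mu^-_{\rm s}(t),$$ that is, $\mu_{\rm ac}(t)=\mu^-_{\rm ac}(t)$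 and $\mu_{\rm s}(t)=(1-\alpha)\mu^-_{\rm s}(t)$. Moreover, for almost every $t>0$, $$\mu^+(t)=\mu^-(t)=\mu(t)=\mu_{\rm ac}(t).$$ -/

import Mathlib

open MeasureTheory Set Filter Topology
open scoped ENNReal NNReal

noncomputable section

/-! ### One-dimensional Sobolev notions -/

/-- `f` is the (locally absolutely continuous) primitive of `g`; equivalently, `f` is continuous and
`g` is its weak derivative.  The function `g` is determined by `f` up to null sets. -/
def HasAEDeriv (f g : ℝ → ℝ) : Prop :=
  LocallyIntegrable g ∧ ∀ a b : ℝ, f b - f a = ∫ x in a..b, g x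

/-- `f ∈ E = L² ∩ L^∞`. -/
def MemE (f : ℝ → ℝ) : Prop := MemLp f 2 ∧ MemLp f ∞

/-! ### Eulerian coordinates -/

/-- A quadruple `(u, ρ, μ, ν)`. -/
structure EulerState where
  u : ℝ → ℝ
  ρ : ℝ → ℝ
  μ : Measure ℝ
  ν : Measure ℝ

/-- Absolutely continuous part of a measure with respect to Lebesgue measure. -/
def acPart (μ : Measure ℝ) : Measure ℝ := volume.withDensity (μ.rnDeriv volume)

/-- Singular part of a measure with respect to Lebesgue measure. -/
def singPart (μ : Measure ℝ) : Measure ℝ := μ.singularPart volume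

/-- The set `𝒟` of Eulerian coordinates: `u ∈ H¹` (continuous representative), `ρ ∈ L²`, `μ` and `ν`
are finite with `μ ≤ ν`, and `μ_ac = (u_x² + ρ²) dx`. -/
structure EulerState.MemD (S : EulerState) : Prop where
  u_memLp : MemLp S.u 2
  ρ_memLp : MemLp S.ρ 2
  finite_μ : IsFiniteMeasure S.μ
  finite_ν : IsFiniteMeasure S.ν
  le : S.μ ≤ S.ν
  deriv_ac : ∃ ux : ℝ → ℝ, MemLp ux 2 ∧ HasAEDeriv S.u ux ∧
    acPart S.μ = volume.withDensity (fun x => ENNReal.ofReal (ux x ^ 2 + S.ρ x ^ 2))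

/-! ### Lagrangian coordinates -/

/-- A tuple `Θ = (y, U, y_ξ, U_ξ, h̄, h, r)`; the components `y_ξ` and `U_ξ` are called `q`, `w`. -/
structure LagState where
  y : ℝ → ℝ
  U : ℝ → ℝ
  q : ℝ → ℝ
  w : ℝ → ℝ
  hbar : ℝ → ℝ
  h : ℝ → ℝ
  r : ℝ → ℝ

/-- `g₁(Θ) = |U_ξ| + 2 y_ξ`. -/
def LagState.g₁ (Θ : LagState) (ξ : ℝ) : ℝ := |Θ.w ξ| + 2 * Θ.q ξ

/-- `g₂(Θ) = y_ξ + h̄`. -/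
def LagState.g₂ (Θ : LagState) (ξ : ℝ) : ℝ := Θ.q ξ + Θ.hbar ξ

open Classical in
/-- `g(Θ) = α g₁(Θ) + (1 - α) g₂(Θ)` where `g₁ ≤ g₂`, `U_ξ ≤ 0` and `r = 0`, and `g(Θ) = g₂(Θ)`
elsewhere. -/
def LagState.g (α : ℝ) (Θ : LagState) (ξ : ℝ) : ℝ :=
  if Θ.g₁ ξ ≤ Θ.g₂ ξ ∧ Θ.w ξ ≤ 0 ∧ Θ.r ξ = 0 then α * Θ.g₁ ξ + (1 - α) * Θ.g₂ ξ else Θ.g₂ ξ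

/-- The set `𝒢` of Lagrangian coordinates, with `ζ = y - id`. -/
structure LagState.MemG (α : ℝ) (Θ : LagState) : Prop where
  y_deriv : HasAEDeriv Θ.y Θ.q
  U_deriv : HasAEDeriv Θ.U Θ.w
  ζ_bdd : MemLp (fun ξ => Θ.y ξ - ξ) ∞
  U_mem : MemE Θ.U
  ζξ_mem : MemE (fun ξ => Θ.q ξ - 1)
  w_mem : MemE Θ.w
  h_mem : MemE Θ.h
  r_mem : MemE Θ.r
  hbar_meas : AEStronglyMeasurable Θ.hbar volume
  g_mem : MemE (fun ξ => Θ.g α ξ - 1)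
  h_int : Integrable Θ.h
  q_nonneg : ∀ᵐ ξ, 0 ≤ Θ.q ξ
  h_nonneg : ∀ᵐ ξ, 0 ≤ Θ.h ξ
  hbar_nonneg : ∀ᵐ ξ, 0 ≤ Θ.hbar ξ
  ζ_lim : Tendsto (fun ξ => Θ.y ξ - ξ) atBot (𝓝 0)
  /-- `1 / (y_ξ + h) ∈ L^∞`. -/
  inv_bdd : ∃ c : ℝ, 0 < c ∧ ∀ᵐ ξ, c ≤ Θ.q ξ + Θ.h ξ
  energy : ∀ᵐ ξ, Θ.q ξ * Θ.hbar ξ = Θ.w ξ ^ 2 + Θ.r ξ ^ 2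
  hbar_le : ∀ᵐ ξ, Θ.hbar ξ ≤ Θ.h ξ

/-- `P(ξ) = ¼ ∫ e^{-|y(ξ) - y(η)|} (2 U² y_ξ + h̄)(η) dη`. -/
def LagState.P (Θ : LagState) (ξ : ℝ) : ℝ :=
  1 / 4 * ∫ η, Real.exp (-|Θ.y ξ - Θ.y η|) * (2 * Θ.U η ^ 2 * Θ.q η + Θ.hbar η)

/-- `Q(ξ) = -¼ ∫ sgn(ξ - η) e^{-|y(ξ) - y(η)|} (2 U² y_ξ + h̄)(η) dη`. -/
def LagState.Q (Θ : LagState) (ξ : ℝ) : ℝ :=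
  -(1 / 4) * ∫ η, Real.sign (ξ - η) *
    (Real.exp (-|Θ.y ξ - Θ.y η|) * (2 * Θ.U η ^ 2 * Θ.q η + Θ.hbar η))

/-! ### Breaking times -/

open Classical in
/-- The first time `t > s` with `f t = 0` and `f > 0` on `(s, t)`, and `∞` if there is none. -/
def nextBreak (f : ℝ → ℝ) (s : EReal) : EReal :=
  if ∃ t : ℝ, s < t ∧ (∀ t' : ℝ, s < t' → t' < t → 0 < f t') ∧ f t = 0 then
    sSup ((fun t : ℝ => (t : EReal)) '' {t : ℝ | s < t ∧ ∀ t' : ℝ, s < t' → t' < t → 0 < f t'})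
  else ⊤

/-- The breaking times `τ_n` of a scalar trajectory `f = y_ξ(·, ξ)`, with `τ_0 = 0`. -/
def breakTime (f : ℝ → ℝ) : ℕ → EReal
  | 0 => 0
  | n + 1 => nextBreak f (breakTime f n)

/-! ### Solutions in Lagrangian coordinates -/

/-- `f ∈ L^∞([0,T], L^p(ℝ))` for all `T`. -/
def BddInTime (p : ℝ≥0∞) (f : ℝ → ℝ → ℝ) : Prop :=
  ∀ T : ℝ, ∃ C : ℝ≥0, ∀ t ∈ Icc 0 T, AEStronglyMeasurable (f t) volume ∧ eLpNorm (f t) p volume ≤ C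

/-- `f ∈ W^{1,∞}([0,T], L^p(ℝ))` for all `T`, in the form: bounded and Lipschitz with values in
`L^p`. -/
def LipInTime (p : ℝ≥0∞) (f : ℝ → ℝ → ℝ) : Prop :=
  BddInTime p f ∧ ∀ T : ℝ, ∃ C : ℝ≥0, ∀ s ∈ Icc 0 T, ∀ t ∈ Icc 0 T,
    eLpNorm (f t - f s) p volume ≤ C * ENNReal.ofReal |t - s|

/-- `f` solves `f' = F` for `t ≥ 0` in the sense of Carathéodory (integrated form). -/
def SolvesODE (f F : ℝ → ℝ) : Prop :=
  ∀ t : ℝ, 0 ≤ t → IntervalIntegrable F volume 0 t ∧ f t = f 0 + ∫ s in (0 : ℝ)..t, F s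

/-- `Θ` is a global `α`-dissipative solution in Lagrangian coordinates, with values in `𝒢`.  The
integrated equations hold across the breaking times, which expresses the evolution and the continuity
of `X = (y, U, y_ξ, U_ξ, h, r)`; `h̄` has the increments of `h` on each `[τ_n, τ_{n+1})` and is
multiplied by `1 - α` at each `τ_n`, `n ≥ 1`. -/
structure IsLagrangianSolution (α : ℝ) (Θ : ℝ → LagState) : Prop where
  memG : ∀ t, 0 ≤ t → (Θ t).MemG α
  ζ_bdd : BddInTime ∞ (fun t ξ => (Θ t).y ξ - ξ)
  U_bdd : BddInTime 2 (fun t => (Θ t).U)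
  q_lip : ∀ p ∈ ({2, ∞} : Set ℝ≥0∞), LipInTime p (fun t ξ => (Θ t).q ξ - 1)
  w_lip : ∀ p ∈ ({2, ∞} : Set ℝ≥0∞), LipInTime p (fun t => (Θ t).w)
  r_lip : ∀ p ∈ ({2, ∞} : Set ℝ≥0∞), LipInTime p (fun t => (Θ t).r)
  hbar_bdd : BddInTime 2 (fun t => (Θ t).hbar)
  h_lip : ∀ p ∈ ({1, ∞} : Set ℝ≥0∞), LipInTime p (fun t => (Θ t).h)
  τ_meas : ∀ n, AEMeasurable (fun ξ => breakTime (fun t => (Θ t).q ξ) n) volume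
  τ_lim : ∀ᵐ ξ, Tendsto (breakTime (fun t => (Θ t).q ξ)) atTop (𝓝 ⊤)
  y_ode : ∀ᵐ ξ, SolvesODE (fun t => (Θ t).y ξ) (fun t => (Θ t).U ξ)
  U_ode : ∀ᵐ ξ, SolvesODE (fun t => (Θ t).U ξ) (fun t => -(Θ t).Q ξ)
  q_ode : ∀ᵐ ξ, SolvesODE (fun t => (Θ t).q ξ) (fun t => (Θ t).w ξ)
  w_ode : ∀ᵐ ξ, SolvesODE (fun t => (Θ t).w ξ)
    (fun t => 1 / 2 * (Θ t).hbar ξ + ((Θ t).U ξ ^ 2 - (Θ t).P ξ) * (Θ t).q ξ)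
  h_ode : ∀ᵐ ξ, SolvesODE (fun t => (Θ t).h ξ)
    (fun t => 2 * ((Θ t).U ξ ^ 2 - (Θ t).P ξ) * (Θ t).w ξ)
  r_ode : ∀ᵐ ξ, ∀ t : ℝ, 0 ≤ t → (Θ t).r ξ = (Θ 0).r ξ
  hbar_ode : ∀ᵐ ξ, ∀ (n : ℕ) (s t : ℝ), breakTime (fun t => (Θ t).q ξ) n ≤ s → s ≤ t →
    t < breakTime (fun t => (Θ t).q ξ) (n + 1) →
    (Θ t).hbar ξ - (Θ s).hbar ξ = (Θ t).h ξ - (Θ s).h ξ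
  hbar_jump : ∀ᵐ ξ, ∀ (n : ℕ) (t : ℝ), breakTime (fun t => (Θ t).q ξ) (n + 1) = t →
    ∃ l : ℝ, Tendsto (fun s => (Θ s).hbar ξ) (𝓝[<] t) (𝓝 l) ∧ (Θ t).hbar ξ = (1 - α) * l

/-! ### From Eulerian to Lagrangian coordinates and back -/

/-- The characteristics `y(ξ) = sup {y | ν((-∞, y)) + y < ξ}`. -/
def EulerState.char (S : EulerState) (ξ : ℝ) : ℝ := sSup {y : ℝ | S.ν.real (Iio y) + y < ξ}

/-- The map `L` from Eulerian to Lagrangian coordinates; here `μ = f ν`. -/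
def EulerState.toLag (S : EulerState) : LagState where
  y := S.char
  U := fun ξ => S.u (S.char ξ)
  q := deriv S.char
  w := deriv (fun ξ => S.u (S.char ξ))
  hbar := fun ξ => (S.μ.rnDeriv S.ν (S.char ξ)).toReal * (1 - deriv S.char ξ)
  h := fun ξ => 1 - deriv S.char ξ
  r := fun ξ => S.ρ (S.char ξ) * deriv S.char ξ

/-- Equality of Lagrangian coordinates: `y`, `U` are continuous functions, the other components are
functions up to null sets. -/
structure LagState.Same (Θ Θ' : LagState) : Prop where
  y : Θ.y = Θ'.y
  U : Θ.U = Θ'.U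
  q : Θ.q =ᵐ[volume] Θ'.q
  w : Θ.w =ᵐ[volume] Θ'.w
  hbar : Θ.hbar =ᵐ[volume] Θ'.hbar
  h : Θ.h =ᵐ[volume] Θ'.h
  r : Θ.r =ᵐ[volume] Θ'.r

/-- `S` is the image `M(Θ)` of the Lagrangian coordinates `Θ`: `u(x) = U(ξ)` whenever `x = y(ξ)`,
`μ = y_#(h̄ dξ)`, `ν = y_#(h dξ)` and `ρ dx = y_#(r dξ)`. -/
structure LagState.IsEuler (Θ : LagState) (S : EulerState) : Prop where
  u : ∀ ξ, S.u (Θ.y ξ) = Θ.U ξ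
  μ : S.μ = (volume.withDensity (fun ξ => ENNReal.ofReal (Θ.hbar ξ))).map Θ.y
  ν : S.ν = (volume.withDensity (fun ξ => ENNReal.ofReal (Θ.h ξ))).map Θ.y
  ρ_loc : LocallyIntegrable S.ρ
  ρ : ∀ A : Set ℝ, MeasurableSet A → Bornology.IsBounded A →
    ∫ x in A, S.ρ x = ∫ ξ in Θ.y ⁻¹' A, Θ.r ξ

/-- `S(t) = T_t S₀ = (M ∘ S_t ∘ L) S₀` for `t ≥ 0`: the `α`-dissipative solution of the
two-component Camassa-Holm system with initial data `S₀`. -/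
def IsAlphaDissipativeSolution (α : ℝ) (S₀ : EulerState) (S : ℝ → EulerState) : Prop :=
  ∃ Θ : ℝ → LagState, IsLagrangianSolution α Θ ∧ (Θ 0).Same S₀.toLag ∧
    ∀ t, 0 ≤ t → (Θ t).IsEuler (S t)

/-! ### Weak-* convergence of measures -/

/-- Weak-* convergence of `m s` to `m₀` along `l`, tested on continuous compactly supported
functions. -/
def WeakStarTendsto (m : ℝ → Measure ℝ) (l : Filter ℝ) (m₀ : Measure ℝ) : Prop :=
  ∀ φ : ℝ → ℝ, Continuous φ → HasCompactSupport φ →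
    Tendsto (fun s => ∫ x, φ x ∂(m s)) l (𝓝 (∫ x, φ x ∂m₀))

end

/-! ### Carathéodory solutions -/

/-! The measure `μ(t)` is the push-forward of `h̄(t) dξ` under the monotone map `y(t)`, so
everything reduces to the behaviour of `h̄` in time along a single characteristic and to the
Lebesgue decomposition of such push-forwards.

Along almost every characteristic, `h̄` differs from the continuous function `h` by a constant
between breaking times. Hence it is right-continuous and has left limits, and it can jump only where
`y_ξ = 0`, by the factor `1 - α`. The delicate case is a zero of `y_ξ` that is not a breaking time.
Such a zero forces zeros to accumulate at the preceding `τ_n`; convexity then gives `h̄(τ_n) = 0`,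
and Grönwall's inequality propagates this, so `h̄ = 0` at that zero (`hb_eq_zero_of_lt`). Therefore
`h̄` equals its left limit where `y_ξ > 0` and `1 - α` times it where `y_ξ = 0`
(`exists_left_limit`).

The area formula and Sard's lemma show that mass sitting where `y' > 0` is pushed to the absolutely
continuous part and the rest to the singular part (`acPart_singPart_map`), which turns the pointwise
relation into the one between `μ` and `μ⁻`. The weak-* limits follow from dominated convergence with
the moving majorant `h(s)`, which converges in `L¹` (`tendsto_integral_hbar`). Finally, each
`τ_n(ξ)` is a single time, so by Fubini almost every `t` is a breaking time only for a null set of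
`ξ`; at such `t` nothing jumps and points with `y_ξ = 0` carry no energy. -/

theorem SolvesODE.intervalIntegrable {f F : ℝ → ℝ} (hf : SolvesODE f F) {a b : ℝ} (ha : 0 ≤ a)
    (hb : 0 ≤ b) : IntervalIntegrable F volume a b :=
  (hf a ha).1.symm.trans (hf b hb).1

theorem SolvesODE.sub_eq {f F : ℝ → ℝ} (hf : SolvesODE f F) {a b : ℝ} (ha : 0 ≤ a)
    (hb : 0 ≤ b) : f b - f a = ∫ s in a..b, F s := by
  rw [(hf a ha).2, (hf b hb).2,
    ← intervalIntegral.integral_interval_sub_left (hf b hb).1 (hf a ha).1]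
  ring

theorem SolvesODE.continuousOn {f F : ℝ → ℝ} (hf : SolvesODE f F) : ContinuousOn f (Ici 0) := by
  intro t ht
  have ht : (0 : ℝ) ≤ t := ht
  have h1 : ContinuousOn (fun x => ∫ s in (0 : ℝ)..x, F s) (uIcc 0 (t + 1)) :=
    intervalIntegral.continuousOn_primitive_interval
      ((intervalIntegrable_iff' (by simp)).1 (hf (t + 1) (by linarith)).1)
  rw [uIcc_of_le (by linarith)] at h1
  have h2 : ContinuousOn f (Icc 0 (t + 1)) := by
    refine (continuousOn_const.add h1 : ContinuousOn (fun x => f 0 + _) _).congr ?_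
    intro x hx
    exact (hf x hx.1).2
  refine (h2 t ⟨ht, by linarith⟩).mono_of_mem_nhdsWithin ?_
  rw [mem_nhdsWithin]
  exact ⟨Iio (t + 1), isOpen_Iio, by simp, fun x hx => ⟨hx.2, le_of_lt hx.1⟩⟩

theorem SolvesODE.continuousAt {f F : ℝ → ℝ} (hf : SolvesODE f F) {t : ℝ} (ht : 0 < t) :
    ContinuousAt f t :=
  hf.continuousOn.continuousAt (Ici_mem_nhds ht)

theorem SolvesODE.tendsto_nhdsGT {f F : ℝ → ℝ} (hf : SolvesODE f F) {t : ℝ} (ht : 0 ≤ t) :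
    Tendsto f (𝓝[>] t) (𝓝 (f t)) :=
  (hf.continuousOn t ht).mono fun _ hx => ht.trans (le_of_lt hx)

/-- Grönwall's inequality in integrated form, with vanishing initial value. -/
theorem eq_zero_of_le_mul_integral {φ : ℝ → ℝ} {a b K : ℝ} (hab : a ≤ b)
    (hφ : ContinuousOn φ (Icc a b)) (h0 : ∀ x ∈ Icc a b, 0 ≤ φ x)
    (hle : ∀ x ∈ Icc a b, φ x ≤ K * ∫ s in a..x, φ s) : ∀ x ∈ Icc a b, φ x = 0 := by
  -- Extending `φ` continuously to the line makes its primitive differentiable everywhere; the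
  -- differential Grönwall inequality is applied to that primitive.
  set ψ : ℝ → ℝ := IccExtend hab ((Icc a b).domRestrict φ) with hψ
  have hψc : Continuous ψ := hφ.domRestrict.Icc_extend'
  have hψφ : ∀ x ∈ Icc a b, ψ x = φ x := fun x hx => by
    rw [hψ, IccExtend_of_mem _ _ hx]; rfl
  have hint : ∀ x ∈ Icc a b, ∫ s in a..x, ψ s = ∫ s in a..x, φ s := fun x hx =>
    intervalIntegral.integral_congr fun s hs => by
      rw [uIcc_of_le hx.1] at hs
      exact hψφ s ⟨hs.1, hs.2.trans hx.2⟩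
  have hder : ∀ x, HasDerivAt (fun x => ∫ s in a..x, ψ s) (ψ x) x := fun x =>
    intervalIntegral.integral_hasDerivAt_right (hψc.intervalIntegrable _ _)
      (hψc.stronglyMeasurableAtFilter _ _) hψc.continuousAt
  have key := norm_le_gronwallBound_of_norm_deriv_right_le (f := fun x => ∫ s in a..x, ψ s)
    (f' := ψ) (δ := 0) (K := K) (ε := 0) (a := a) (b := b)
    (fun x _ => (hder x).continuousAt.continuousWithinAt)
    (fun x _ => (hder x).hasDerivWithinAt) (by simp) (fun x hx => by
      have hx' := Ico_subset_Icc_self hx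
      have hnn : 0 ≤ ∫ s in a..x, φ s := intervalIntegral.integral_nonneg hx.1 fun s hs =>
        h0 s ⟨hs.1, hs.2.trans hx'.2⟩
      rw [hint x hx', hψφ x hx', Real.norm_of_nonneg (h0 x hx'), Real.norm_of_nonneg hnn]
      linarith [hle x hx'])
  intro x hx
  have h1 := key x hx
  rw [gronwallBound_ε0_δ0, norm_le_zero_iff, hint x hx] at h1
  have h2 := hle x hx
  rw [h1, mul_zero] at h2
  exact le_antisymm h2 (h0 x hx)

/-! ### Breaking times -/

theorem lt_nextBreak {f : ℝ → ℝ} {s : EReal} (hs : s ≠ ⊤) : s < nextBreak f s := by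
  unfold nextBreak
  split_ifs with h
  · obtain ⟨t, ht, hpos, -⟩ := h
    exact ht.trans_le (le_sSup ⟨t, ⟨ht, hpos⟩, rfl⟩)
  · exact lt_top_iff_ne_top.2 hs

theorem le_nextBreak (f : ℝ → ℝ) (s : EReal) : s ≤ nextBreak f s := by
  by_cases hs : s = ⊤
  · subst hs
    unfold nextBreak
    simp
  · exact (lt_nextBreak hs).le

/-- A competitor beyond `t` would require `f t > 0`. Thus the supremum in `nextBreak` is attained at
the first zero. -/
theorem sSup_eq_of_first_zero {f : ℝ → ℝ} {s : EReal} {t : ℝ} (ht : s < t)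
    (hpos : ∀ t' : ℝ, s < t' → t' < t → 0 < f t') (hzero : f t = 0) :
    sSup ((fun t : ℝ => (t : EReal)) '' {t : ℝ | s < t ∧ ∀ t' : ℝ, s < t' → t' < t → 0 < f t'})
      = t := by
  refine le_antisymm (sSup_le ?_) (le_sSup ⟨t, ⟨ht, hpos⟩, rfl⟩)
  rintro _ ⟨x, ⟨-, hx⟩, rfl⟩
  refine EReal.coe_le_coe_iff.2 (not_lt.1 fun hlt => ?_)
  exact (hx t ht hlt).ne' hzero

theorem apply_eq_zero_of_nextBreak_eq {f : ℝ → ℝ} {s : EReal} {t : ℝ}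
    (h : nextBreak f s = t) : f t = 0 := by
  unfold nextBreak at h
  split_ifs at h with hex
  · obtain ⟨x, hx, hpos, hzero⟩ := hex
    rw [sSup_eq_of_first_zero hx hpos hzero, EReal.coe_eq_coe_iff] at h
    exact h ▸ hzero
  · exact absurd h.symm (EReal.coe_ne_top t)

/-- A zero strictly before the next breaking time forces zeros to accumulate at the current one. -/
theorem exists_zero_of_lt_nextBreak {f : ℝ → ℝ} {a t : ℝ} (hf : ContinuousOn f (Ici a))
    (hf0 : ∀ x, a ≤ x → 0 ≤ f x) (hat : a < t) (htn : (t : EReal) < nextBreak f a)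
    (hzero : f t = 0) {b : ℝ} (hb : a < b) : ∃ x ∈ Ioo a b, f x = 0 := by
  by_contra! hne
  -- Starting at `c > a` keeps the zero set compact and nonempty. With no zeros in `(a, b)`, its
  -- least element is the first zero after `a`, hence the next breaking time, yet it is at most `t`.
  obtain ⟨c, hac, hcm⟩ := exists_between (lt_min hb hat)
  obtain ⟨hcb, hct⟩ := lt_min_iff.1 hcm
  set Z := Icc c t ∩ f ⁻¹' {0} with hZ
  have hZc : IsCompact Z := by
    refine isCompact_Icc.of_isClosed_subset ?_ inter_subset_left
    exact (hf.mono fun x hx => hac.le.trans hx.1).preimage_isClosed_of_isClosed isClosed_Icc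
      isClosed_singleton
  obtain ⟨x, hx⟩ := hZc.exists_isLeast ⟨t, ⟨hct.le, le_rfl⟩, hzero⟩
  have hax : a < x := hac.trans_le hx.1.1.1
  have hpos : ∀ t' : ℝ, (a : EReal) < t' → t' < x → 0 < f t' := by
    intro t' h1 h2
    have h1 : a < t' := EReal.coe_lt_coe_iff.1 h1
    refine (hf0 t' h1.le).lt_of_ne' fun h0 => ?_
    rcases lt_or_ge t' b with h3 | h3
    · exact hne t' ⟨h1, h3⟩ h0
    · exact h2.not_ge (hx.2 ⟨⟨hcb.le.trans h3, h2.le.trans hx.1.1.2⟩, h0⟩)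
  have hax' : (a : EReal) < x := EReal.coe_lt_coe_iff.2 hax
  have : nextBreak f a = x := by
    unfold nextBreak
    rw [if_pos ⟨x, hax', hpos, hx.1.2⟩]
    exact sSup_eq_of_first_zero hax' hpos hx.1.2
  rw [this, EReal.coe_lt_coe_iff] at htn
  exact htn.not_ge hx.1.1.2

theorem breakTime_mono (f : ℝ → ℝ) : Monotone (breakTime f) :=
  monotone_nat_of_le_succ fun _ => le_nextBreak f _

theorem breakTime_nonneg (f : ℝ → ℝ) (n : ℕ) : 0 ≤ breakTime f n :=
  breakTime_mono f (Nat.zero_le n)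

/-- Every time lies in exactly one interval between consecutive breaking times; this is the
half-open version, closed on the left. -/
theorem exists_breakTime_le_lt {f : ℝ → ℝ} (hf : Tendsto (breakTime f) atTop (𝓝 ⊤)) {t : ℝ}
    (ht : 0 ≤ t) : ∃ n, breakTime f n ≤ t ∧ (t : EReal) < breakTime f (n + 1) := by
  classical
  -- The first index with `τ_n > t` is positive because `τ_0 = 0`; its predecessor is the one
  -- sought.
  have hex : ∃ n, (t : EReal) < breakTime f n :=
    ((tendsto_order.1 hf).1 _ (EReal.coe_lt_top t)).exists
  have h0 : Nat.find hex ≠ 0 := fun h => by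
    have := Nat.find_spec hex
    rw [h] at this
    exact this.not_ge (EReal.coe_nonneg.2 ht)
  obtain ⟨m, hm⟩ := Nat.exists_eq_succ_of_ne_zero h0
  refine ⟨m, not_lt.1 (Nat.find_min hex (by omega)), ?_⟩
  have := Nat.find_spec hex
  rwa [hm] at this

/-- The half-open version, closed on the right. -/
theorem exists_breakTime_lt_le {f : ℝ → ℝ} (hf : Tendsto (breakTime f) atTop (𝓝 ⊤)) {t : ℝ}
    (ht : 0 < t) : ∃ n, breakTime f n < t ∧ (t : EReal) ≤ breakTime f (n + 1) := by
  classical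
  have hex : ∃ n, (t : EReal) ≤ breakTime f n :=
    ((tendsto_order.1 hf).1 _ (EReal.coe_lt_top t)).exists.imp fun _ h => h.le
  have h0 : Nat.find hex ≠ 0 := fun h => by
    have := Nat.find_spec hex
    rw [h] at this
    exact this.not_gt (EReal.coe_pos.2 ht)
  obtain ⟨m, hm⟩ := Nat.exists_eq_succ_of_ne_zero h0
  refine ⟨m, not_le.1 (Nat.find_min hex (by omega)), ?_⟩
  have := Nat.find_spec hex
  rwa [hm] at this

theorem exists_coe_eq_breakTime {f : ℝ → ℝ} {n : ℕ} {t : ℝ} (h : breakTime f n ≤ t) :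
    ∃ a : ℝ, 0 ≤ a ∧ a ≤ t ∧ breakTime f n = a := by
  have h0 := breakTime_nonneg f n
  lift breakTime f n to ℝ using
    ⟨ne_top_of_le_ne_top (EReal.coe_ne_top t) h, ne_bot_of_le_ne_bot (by simp) h0⟩ with a
  exact ⟨a, EReal.coe_nonneg.1 h0, EReal.coe_le_coe_iff.1 h, rfl⟩

/-! ### A single trajectory -/

/-- Right-continuity in time of `h̄`. -/
theorem tendsto_nhdsGT_of_increments {q h hb : ℝ → ℝ}
    (hτ : Tendsto (breakTime q) atTop (𝓝 ⊤))
    (hh : ∀ t, 0 ≤ t → Tendsto h (𝓝[>] t) (𝓝 (h t)))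
    (hinc : ∀ (n : ℕ) (s t : ℝ), breakTime q n ≤ s → s ≤ t → t < breakTime q (n + 1) →
      hb t - hb s = h t - h s) {t : ℝ} (ht : 0 ≤ t) :
    Tendsto hb (𝓝[>] t) (𝓝 (hb t)) := by
  obtain ⟨n, h1, h2⟩ := exists_breakTime_le_lt hτ ht
  obtain ⟨b, htb, hb2⟩ := EReal.lt_iff_exists_real_btwn.1 h2
  have htb : t < b := EReal.coe_lt_coe_iff.1 htb
  have h3 : Tendsto (fun s => hb t + (h s - h t)) (𝓝[>] t) (𝓝 (hb t + (h t - h t))) :=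
    tendsto_const_nhds.add ((hh t ht).sub tendsto_const_nhds)
  rw [sub_self, add_zero] at h3
  refine h3.congr' ?_
  filter_upwards [Ioo_mem_nhdsGT htb] with s hs
  have := hinc n t s h1 hs.1.le ((EReal.coe_lt_coe_iff.2 hs.2).trans hb2)
  linarith

/-- The system satisfied by `(q, w, h, h̄) = (y_ξ, U_ξ, h, h̄)` along a single characteristic, with
`A = U² - P` and `r` constant. -/
structure IsTrajectory (α : ℝ) (q w h hb A : ℝ → ℝ) (r : ℝ) : Prop where
  q_ode : SolvesODE q w
  w_ode : SolvesODE w (fun t => 1 / 2 * hb t + A t * q t)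
  h_ode : SolvesODE h (fun t => 2 * A t * w t)
  q_nonneg : ∀ t, 0 ≤ t → 0 ≤ q t
  hb_nonneg : ∀ t, 0 ≤ t → 0 ≤ hb t
  energy : ∀ t, 0 ≤ t → q t * hb t = w t ^ 2 + r ^ 2
  A_bdd : ∀ T, ∃ C, ∀ t ∈ Icc 0 T, |A t| ≤ C
  τ_lim : Tendsto (breakTime q) atTop (𝓝 ⊤)
  incr : ∀ (n : ℕ) (s t : ℝ), breakTime q n ≤ s → s ≤ t → t < breakTime q (n + 1) →
    hb t - hb s = h t - h s
  jump : ∀ (n : ℕ) (t : ℝ), breakTime q (n + 1) = t →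
    ∃ l : ℝ, Tendsto hb (𝓝[<] t) (𝓝 l) ∧ hb t = (1 - α) * l

namespace IsTrajectory

variable {α r : ℝ} {q w h hb A : ℝ → ℝ}

theorem tendsto_hb_nhdsGT (H : IsTrajectory α q w h hb A r) {t : ℝ} (ht : 0 ≤ t) :
    Tendsto hb (𝓝[>] t) (𝓝 (hb t)) :=
  tendsto_nhdsGT_of_increments H.τ_lim (fun _ h => H.h_ode.tendsto_nhdsGT h) H.incr ht

theorem w_eq_zero (H : IsTrajectory α q w h hb A r) {t : ℝ} (ht : 0 ≤ t) (hq : q t = 0) :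
    w t = 0 := by
  have := H.energy t ht
  rw [hq, zero_mul] at this
  nlinarith [sq_nonneg (w t), sq_nonneg r]

/-- If zeros of `q` accumulate at `a` from the right, then `h̄` vanishes there, since otherwise `q`
would be strictly convex. -/
theorem hb_eq_zero_of_accumulation (H : IsTrajectory α q w h hb A r) {a : ℝ} (ha : 0 ≤ a)
    (hqa : q a = 0) (hacc : ∀ b, a < b → ∃ x ∈ Ioo a b, q x = 0) : hb a = 0 := by
  by_contra hne
  have hpos : 0 < hb a := (H.hb_nonneg a ha).lt_of_ne' hne
  obtain ⟨C, hC⟩ := H.A_bdd (a + 1)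
  have hC0 : 0 ≤ C := (abs_nonneg _).trans (hC a ⟨ha, by linarith⟩)
  have hq0 : Tendsto (fun s => C * q s) (𝓝[>] a) (𝓝 (C * 0)) :=
    (hqa ▸ H.q_ode.tendsto_nhdsGT ha).const_mul C
  rw [mul_zero] at hq0
  -- Near `a`, `h̄/2` exceeds `h̄(a)/4` while `|A q| ≤ C q` stays below it. So `w` increases from
  -- `w(a) = 0`, and then `q` from `q(a) = 0`, leaving no room for zeros.
  have hev : ∀ᶠ s in 𝓝[>] a, 0 < 1 / 2 * hb s + A s * q s := by
    filter_upwards [(tendsto_order.1 (H.tendsto_hb_nhdsGT ha)).1 (hb a / 2) (by linarith),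
      (tendsto_order.1 hq0).2 (hb a / 4) (by linarith),
      Ioo_mem_nhdsGT (show a < a + 1 by linarith)] with s h1 h2 h3
    have h4 : 0 ≤ s := ha.trans h3.1.le
    have h5 := mul_le_mul_of_nonneg_right (hC s ⟨h4, h3.2.le⟩) (H.q_nonneg s h4)
    have h6 := mul_le_mul_of_nonneg_right (neg_abs_le (A s)) (H.q_nonneg s h4)
    nlinarith
  obtain ⟨b, hab, hb'⟩ := (mem_nhdsGT_iff_exists_Ioo_subset).1 hev
  have hw : ∀ s ∈ Ioo a b, 0 < w s := fun s hs => by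
    have h0 : 0 ≤ s := ha.trans hs.1.le
    have h1 := H.w_ode.sub_eq ha h0
    rw [H.w_eq_zero ha hqa, sub_zero] at h1
    rw [h1]
    exact intervalIntegral.intervalIntegral_pos_of_pos_on (H.w_ode.intervalIntegrable ha h0)
      (fun x hx => hb' ⟨hx.1, hx.2.trans hs.2⟩) hs.1
  obtain ⟨x, hx, hqx⟩ := hacc b hab
  have h0 : 0 ≤ x := ha.trans hx.1.le
  have h1 := H.q_ode.sub_eq ha h0
  rw [hqa, hqx, sub_zero] at h1
  exact (intervalIntegral.intervalIntegral_pos_of_pos_on (H.q_ode.intervalIntegrable ha h0)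
      (fun s hs => hw s ⟨hs.1, hs.2.trans hx.2⟩) hx.1).ne h1

/-- If `q` and `h̄` vanish at some time, then they vanish up to the next breaking time. -/
theorem hb_eq_zero_of_vanishing (H : IsTrajectory α q w h hb A r) {a b : ℝ} (ha : 0 ≤ a)
    (hab : a ≤ b) (hqa : q a = 0)
    (hinc : ∀ t ∈ Icc a b, hb t = h t - h a) : hb b = 0 := by
  obtain ⟨C, hC⟩ := H.A_bdd b
  have hC0 : 0 ≤ C := (abs_nonneg _).trans (hC a ⟨ha, hab⟩)
  have hsub : Icc a b ⊆ Ici 0 := fun x hx => ha.trans hx.1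
  have hcb : ContinuousOn hb (Icc a b) :=
    ((H.h_ode.continuousOn.mono hsub).sub continuousOn_const).congr hinc
  -- Since `hinc` at `t = a` gives `h̄(a) = 0`, the triple `(q, w, h̄)` solves a homogeneous linear
  -- system with bounded coefficients and zero initial data. The constant `2 + 3C` below is the sum
  -- of `1`, `1 + C` and `2C`.
  set φ : ℝ → ℝ := fun t => |q t| + |w t| + |hb t| with hφ
  have hφc : ContinuousOn φ (Icc a b) :=
    ((H.q_ode.continuousOn.mono hsub).abs.add (H.w_ode.continuousOn.mono hsub).abs).add hcb.abs
  have hle : ∀ x ∈ Icc a b, φ x ≤ (2 + 3 * C) * ∫ s in a..x, φ s := by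
    intro x hx
    have hx0 : 0 ≤ x := hsub hx
    have hφi : IntervalIntegrable φ volume a x :=
      (hφc.mono (by rw [uIcc_of_le hx.1]; exact Icc_subset_Icc_right hx.2)).intervalIntegrable
    have est : ∀ (F : ℝ → ℝ) (k : ℝ), (∀ s ∈ Icc a x, |F s| ≤ k * φ s) →
        |∫ s in a..x, F s| ≤ k * ∫ s in a..x, φ s := by
      intro F k hF
      rw [← intervalIntegral.integral_const_mul, ← Real.norm_eq_abs]
      exact intervalIntegral.norm_integral_le_of_norm_le hx.1
        (Eventually.of_forall fun s hs => hF s (Ioc_subset_Icc_self hs)) (hφi.const_mul k)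
    have hA : ∀ s ∈ Icc a x, |A s| ≤ C := fun s hs => hC s ⟨ha.trans hs.1, hs.2.trans hx.2⟩
    have e1 : |q x| ≤ 1 * ∫ s in a..x, φ s := by
      have h1 := H.q_ode.sub_eq ha hx0
      rw [hqa, sub_zero] at h1
      rw [h1]
      refine est _ _ fun s hs => ?_
      have := abs_nonneg (q s)
      have := abs_nonneg (hb s)
      simp only [hφ]
      linarith
    have e2 : |w x| ≤ (1 + C) * ∫ s in a..x, φ s := by
      have h1 := H.w_ode.sub_eq ha hx0
      rw [H.w_eq_zero ha hqa, sub_zero] at h1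
      rw [h1]
      refine est _ _ fun s hs => ?_
      have h2 : |1 / 2 * hb s + A s * q s| ≤ 1 / 2 * |hb s| + |A s| * |q s| := by
        refine (abs_add_le _ _).trans ?_
        rw [abs_mul, abs_mul, abs_of_pos (by norm_num : (0 : ℝ) < 1 / 2)]
      have h3 := mul_le_mul_of_nonneg_right (hA s hs) (abs_nonneg (q s))
      have h4 := abs_nonneg (q s)
      have h5 := abs_nonneg (hb s)
      have h6 := abs_nonneg (w s)
      simp only [hφ]
      nlinarith [mul_nonneg hC0 h5, mul_nonneg hC0 h6]
    have e3 : |hb x| ≤ (2 * C) * ∫ s in a..x, φ s := by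
      rw [hinc x hx, H.h_ode.sub_eq ha hx0]
      refine est _ _ fun s hs => ?_
      have h3 := mul_le_mul_of_nonneg_right (hA s hs) (abs_nonneg (w s))
      have h4 := abs_nonneg (q s)
      have h5 := abs_nonneg (hb s)
      rw [abs_mul, abs_mul, abs_two]
      simp only [hφ]
      nlinarith [mul_nonneg hC0 h5, mul_nonneg hC0 h4]
    simp only [hφ] at e1 e2 e3 ⊢
    linarith
  have h0 := eq_zero_of_le_mul_integral hab hφc (fun x _ => by positivity) hle b ⟨hab, le_rfl⟩
  simp only [hφ] at h0
  have h4 := abs_nonneg (q b)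
  have h5 := abs_nonneg (hb b)
  have h6 := abs_nonneg (w b)
  exact abs_eq_zero.1 (by linarith)

/-- Away from breaking times, a degenerate point carries no energy. -/
theorem hb_eq_zero_of_lt (H : IsTrajectory α q w h hb A r) {n : ℕ} {t : ℝ}
    (h1 : breakTime q n < t) (h2 : (t : EReal) < breakTime q (n + 1)) (hq : q t = 0) :
    hb t = 0 := by
  obtain ⟨a, ha, hat, hae⟩ := exists_coe_eq_breakTime h1.le
  have hat : a < t := by rw [hae] at h1; exact EReal.coe_lt_coe_iff.1 h1
  have hacc : ∀ b, a < b → ∃ x ∈ Ioo a b, q x = 0 := fun b hb =>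
    exists_zero_of_lt_nextBreak (H.q_ode.continuousOn.mono (Ici_subset_Ici.2 ha))
      (fun x hx => H.q_nonneg x (ha.trans hx)) hat (by rw [← hae]; exact h2) hq hb
  have hfreq : ∃ᶠ x in 𝓝[>] a, q x ∈ ({0} : Set ℝ) := by
    rw [frequently_iff]
    intro V hV
    obtain ⟨b, hab, hV⟩ := mem_nhdsGT_iff_exists_Ioo_subset.1 hV
    obtain ⟨x, hx, hx0⟩ := hacc b hab
    exact ⟨x, hV hx, hx0⟩
  have hqa : q a = 0 :=
    isClosed_singleton.mem_of_frequently_of_tendsto hfreq (H.q_ode.tendsto_nhdsGT ha)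
  have hba := H.hb_eq_zero_of_accumulation ha hqa hacc
  refine H.hb_eq_zero_of_vanishing ha hat.le hqa fun s hs => ?_
  have := H.incr n a s hae.le hs.1 ((EReal.coe_le_coe_iff.2 hs.2).trans_lt h2)
  rwa [hba, sub_zero] at this

/-- Behaviour of `h̄` at a given positive time. -/
theorem exists_left_limit (H : IsTrajectory α q w h hb A r) {t : ℝ} (ht : 0 < t) :
    ∃ l : ℝ, Tendsto hb (𝓝[<] t) (𝓝 l) ∧ (0 < q t → hb t = l) ∧
      (q t = 0 → hb t = (1 - α) * l) ∧
      ((∀ n, breakTime q (n + 1) ≠ t) → hb t = l ∧ (q t = 0 → hb t = 0)) := by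
  obtain ⟨n, h1, h2⟩ := exists_breakTime_lt_le H.τ_lim ht
  -- Either `t` is a breaking time, where the jump rule applies and `q t = 0`, or `h̄` is continuous
  -- at `t`. In the second case `q t = 0` gives `h̄ = 0`, so the factor `1 - α` is harmless.
  rcases h2.eq_or_lt with h2 | h2
  · obtain ⟨l, hl, hbl⟩ := H.jump n t h2.symm
    refine ⟨l, hl, fun hq => ?_, fun _ => hbl, fun hne => absurd h2.symm (hne n)⟩
    exact absurd (apply_eq_zero_of_nextBreak_eq h2.symm) hq.ne'
  · have hz := H.hb_eq_zero_of_lt h1 h2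
    refine ⟨hb t, ?_, fun _ => rfl, fun hq => by rw [hz hq, mul_zero], fun _ => ⟨rfl, hz⟩⟩
    obtain ⟨a, ha, hat, hae⟩ := exists_coe_eq_breakTime h1.le
    have hat : a < t := by rw [hae] at h1; exact EReal.coe_lt_coe_iff.1 h1
    have h3 : Tendsto (fun s => hb t - (h t - h s)) (𝓝[<] t) (𝓝 (hb t - (h t - h t))) :=
      tendsto_const_nhds.sub (tendsto_const_nhds.sub
        ((H.h_ode.continuousAt ht).tendsto.mono_left nhdsWithin_le_nhds))
    rw [sub_self, sub_zero] at h3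
    refine h3.congr' ?_
    filter_upwards [Ioo_mem_nhdsLT hat] with s hs
    have := H.incr n s t (hae.le.trans (EReal.coe_le_coe_iff.2 hs.1.le)) hs.2.le h2
    linarith

end IsTrajectory

/-! ### Push-forward by an absolutely continuous monotone function -/

theorem HasAEDeriv.continuous {f g : ℝ → ℝ} (hf : HasAEDeriv f g) : Continuous f := by
  have h : f = fun x => f 0 + ∫ s in (0 : ℝ)..x, g s := by
    funext x
    rw [← hf.2 0 x]
    ring
  rw [h]
  refine continuous_const.add (intervalIntegral.continuous_primitive (fun a b => ?_) 0)
  exact (hf.1.integrableOn_isCompact isCompact_uIcc).intervalIntegrable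

theorem HasAEDeriv.ae_hasDerivAt {f g : ℝ → ℝ} (hf : HasAEDeriv f g) :
    ∀ᵐ x, HasDerivAt f (g x) x := by
  have h : f = fun x => f 0 + ∫ s in (0 : ℝ)..x, g s := by
    funext x
    rw [← hf.2 0 x]
    ring
  filter_upwards [LocallyIntegrable.ae_hasDerivAt_integral hf.1] with x hx
  rw [h]
  exact (hx 0).const_add (f 0)

theorem HasAEDeriv.monotone {f g : ℝ → ℝ} (hf : HasAEDeriv f g) (hg : ∀ᵐ x, 0 ≤ g x) :
    Monotone f := fun a b hab => by
  have := intervalIntegral.integral_nonneg_of_ae (μ := volume) hab hg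
  rw [← hf.2 a b] at this
  linarith

/-- The points where `f` has a positive derivative. -/
def posDerivSet (f : ℝ → ℝ) : Set ℝ := {x | DifferentiableAt ℝ f x ∧ 0 < deriv f x}

theorem measurableSet_posDerivSet (f : ℝ → ℝ) : MeasurableSet (posDerivSet f) :=
  (measurableSet_of_differentiableAt ℝ f).inter (measurableSet_lt measurable_const
    (measurable_deriv f))

/-- Equal values at two points make a monotone function constant between them, so its derivative at
the left point would vanish. -/
theorem Monotone.injOn_posDerivSet {f : ℝ → ℝ} (hf : Monotone f) :
    InjOn f (posDerivSet f) := by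
  have key : ∀ a ∈ posDerivSet f, ∀ b, a < b → f a < f b := by
    intro a ha b hab
    refine (hf hab.le).lt_of_ne fun heq => ha.2.ne' ?_
    have hc : ∀ x ∈ Icc a b, f x = f a := fun x hx =>
      le_antisymm ((hf hx.2).trans heq.ge) (hf hx.1)
    have h1 : HasDerivWithinAt f 0 (Icc a b) a :=
      (hasDerivWithinAt_const a _ (f a)).congr hc rfl
    exact (uniqueDiffOn_Icc hab a ⟨le_rfl, hab.le⟩).eq_deriv _
      ha.1.hasDerivAt.hasDerivWithinAt h1
  intro a ha b hb heq
  rcases lt_trichotomy a b with h | h | h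
  · exact absurd heq (key a ha b h).ne
  · exact h
  · exact absurd heq (key b hb a h).ne'

/-- By injectivity and the area formula, the integral of `f'` over the set is the measure of its
image, which lies in `N`; but `f' > 0` on the set. -/
theorem Monotone.volume_preimage_inter_posDerivSet {f : ℝ → ℝ} (hf : Monotone f) {N : Set ℝ}
    (hN : MeasurableSet N) (h0 : volume N = 0) : volume (f ⁻¹' N ∩ posDerivSet f) = 0 := by
  set s := f ⁻¹' N ∩ posDerivSet f with hs
  have hsm : MeasurableSet s := (hf.measurable hN).inter (measurableSet_posDerivSet f)
  have h1 := lintegral_image_eq_lintegral_abs_deriv_mul (f := f) (f' := deriv f) hsm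
    (fun x hx => hx.2.1.hasDerivAt.hasDerivWithinAt) (hf.injOn_posDerivSet.mono inter_subset_right)
    (fun _ => 1)
  simp only [mul_one, lintegral_one, Measure.restrict_apply_univ] at h1
  have h2 : volume (f '' s) = 0 :=
    measure_mono_null (image_subset_iff.2 inter_subset_left) h0
  rw [h2, eq_comm, lintegral_eq_zero_iff (measurable_deriv f).abs.ennreal_ofReal] at h1
  have h3 : ∀ᵐ x ∂volume.restrict s, False := by
    filter_upwards [h1, ae_restrict_mem hsm] with x hx hxs
    have := ENNReal.ofReal_eq_zero.1 hx
    rw [abs_nonpos_iff] at this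
    exact hxs.2.2.ne' this
  simpa [ae_iff] using h3

/-- One-dimensional Sard lemma; no regularity beyond differentiability on the set is needed. -/
theorem volume_image_deriv_eq_zero (f : ℝ → ℝ) :
    volume (f '' {x | DifferentiableAt ℝ f x ∧ deriv f x = 0}) = 0 := by
  refine addHaar_image_eq_zero_of_det_fderivWithin_eq_zero (μ := volume)
    (f' := fun _ => (0 : ℝ →L[ℝ] ℝ)) (fun x hx => ?_) fun x _ => ?_
  · have := hx.1.hasDerivAt
    rw [hx.2, hasDerivAt_iff_hasFDerivAt] at this
    simpa using this.hasFDerivWithinAt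
  · simp [ContinuousLinearMap.det]

/-- Uniqueness of the Lebesgue decomposition. -/
theorem acPart_singPart_add {a s : Measure ℝ} [IsFiniteMeasure a] [IsFiniteMeasure s]
    (ha : a ≪ volume) (hs : s ⟂ₘ volume) : acPart (a + s) = a ∧ singPart (a + s) = s := by
  have h : a + s = s + volume.withDensity (a.rnDeriv volume) := by
    rw [Measure.withDensity_rnDeriv_eq _ _ ha, add_comm]
  refine ⟨?_, (Measure.eq_singularPart (Measure.measurable_rnDeriv _ _) hs h).symm⟩
  rw [acPart, ← Measure.eq_withDensity_rnDeriv (Measure.measurable_rnDeriv _ _) hs h,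
    Measure.withDensity_rnDeriv_eq _ _ ha]

/-- Lebesgue decomposition of the push-forward of a measure with density by a monotone absolutely
continuous function. -/
theorem acPart_singPart_map {y q : ℝ → ℝ} (hy : HasAEDeriv y q) (hq : ∀ᵐ x, 0 ≤ q x)
    {m : Measure ℝ} [IsFiniteMeasure m] (hm : m ≪ volume) :
    acPart (m.map y) = (m.restrict (posDerivSet y)).map y ∧
      singPart (m.map y) = (m.restrict (posDerivSet y)ᶜ).map y := by
  have hmono := hy.monotone hq
  have hym : Measurable y := hmono.measurable
  have hP := measurableSet_posDerivSet y
  have hsplit : m.map y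
      = (m.restrict (posDerivSet y)).map y + (m.restrict (posDerivSet y)ᶜ).map y := by
    rw [← Measure.map_add _ _ hym, Measure.restrict_add_restrict_compl hP]
  rw [hsplit]
  refine acPart_singPart_add ?_ ?_
  · refine Measure.AbsolutelyContinuous.mk fun N hN h0 => ?_
    rw [Measure.map_apply hym hN, Measure.restrict_apply (hym hN)]
    exact hm (hmono.volume_preimage_inter_posDerivSet hN h0)
  · set B := {x | DifferentiableAt ℝ y x ∧ deriv y x = 0} with hB
    -- The separating set is a measurable null hull of the critical values. A point mapped outside
    -- it is not critical, so it has positive derivative unless it belongs to the null set where `y'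
    -- = q ≥ 0` fails.
    refine ⟨(toMeasurable volume (y '' B))ᶜ, (measurableSet_toMeasurable _ _).compl, ?_, ?_⟩
    · rw [Measure.map_apply hym (measurableSet_toMeasurable _ _).compl,
        Measure.restrict_apply (hym (measurableSet_toMeasurable _ _).compl)]
      refine hm (measure_mono_null ?_ (ae_iff.1 (hy.ae_hasDerivAt.and hq)))
      rintro x ⟨hx1, hx2⟩ ⟨hd, h0⟩
      have hxB : x ∉ B := fun h => hx1 (subset_toMeasurable _ _ (mem_image_of_mem y h))
      have hne : deriv y x ≠ 0 := fun h => hxB ⟨hd.differentiableAt, h⟩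
      rw [hd.deriv] at hne
      exact hx2 ⟨hd.differentiableAt, by rw [hd.deriv]; exact h0.lt_of_ne' hne⟩
    · rw [compl_compl, measure_toMeasurable, volume_image_deriv_eq_zero]

theorem HasAEDeriv.ae_mem_posDerivSet_iff {y q : ℝ → ℝ} (hy : HasAEDeriv y q) :
    ∀ᵐ x, (x ∈ posDerivSet y ↔ 0 < q x) := by
  filter_upwards [hy.ae_hasDerivAt] with x hx
  simp only [posDerivSet, mem_ofPred_eq, hx.deriv, hx.differentiableAt, true_and]

/-! ### Limits of integrals dominated by an `L¹`-convergent family -/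

/-- Dominated convergence with a majorant that moves with `s`. Truncating `F s` to `[-g₀, g₀]` gives
a family dominated by `g₀`, and the truncation error is at most `|g s - g₀|`. -/
theorem tendsto_integral_of_le_of_tendsto {ι : Type*} {l : Filter ι} [l.IsCountablyGenerated]
    {F : ι → ℝ → ℝ} {F₀ : ℝ → ℝ} {g : ι → ℝ → ℝ} {g₀ : ℝ → ℝ}
    (hF : ∀ᶠ s in l, AEStronglyMeasurable (F s) volume)
    (hle : ∀ᶠ s in l, ∀ᵐ x, |F s x| ≤ g s x)
    (hg : ∀ᶠ s in l, Integrable (g s)) (hg₀ : Integrable g₀)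
    (hgl : Tendsto (fun s => ∫ x, |g s x - g₀ x|) l (𝓝 0))
    (hle₀ : ∀ᵐ x, |F₀ x| ≤ g₀ x)
    (hlim : ∀ᵐ x, Tendsto (fun s => F s x) l (𝓝 (F₀ x))) :
    Tendsto (fun s => ∫ x, F s x) l (𝓝 (∫ x, F₀ x)) := by
  set G : ι → ℝ → ℝ := fun s x => max (-g₀ x) (min (F s x) (g₀ x)) with hG
  have hGm : ∀ᶠ s in l, AEStronglyMeasurable (G s) volume := by
    filter_upwards [hF] with s hs
    exact hg₀.1.neg.sup (hs.inf hg₀.1)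
  have hGb : ∀ᶠ s in l, ∀ᵐ x, ‖G s x‖ ≤ g₀ x := by
    refine Eventually.of_forall fun s => ?_
    filter_upwards [hle₀] with x hx
    have h0 := (abs_nonneg _).trans hx
    rw [Real.norm_eq_abs, abs_le]
    exact ⟨le_max_left _ _, max_le (by linarith) (min_le_right _ _)⟩
  have h1 : Tendsto (fun s => ∫ x, G s x) l (𝓝 (∫ x, F₀ x)) := by
    refine tendsto_integral_filter_of_dominated_convergence g₀ hGm hGb hg₀ ?_
    filter_upwards [hle₀, hlim] with x hx hxl
    have h2 : Tendsto (fun s => G s x) l (𝓝 (max (-g₀ x) (min (F₀ x) (g₀ x)))) :=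
      tendsto_const_nhds.max (hxl.min tendsto_const_nhds)
    rwa [min_eq_left (le_of_abs_le hx), max_eq_right (neg_le_of_abs_le hx)] at h2
  have h2 : Tendsto (fun s => (∫ x, F s x) - ∫ x, G s x) l (𝓝 0) := by
    refine squeeze_zero_norm' ?_ hgl
    filter_upwards [hF, hle, hg, hGm, hGb] with s a1 a2 a3 a4 a5
    have b1 : Integrable (F s) := a3.mono' a1 a2
    have b2 : Integrable (G s) := hg₀.mono' a4 a5
    rw [← integral_sub b1 b2]
    refine norm_integral_le_of_norm_le (a3.sub hg₀).abs ?_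
    filter_upwards [a2, hle₀] with x hx hx₀
    have h0 := (abs_nonneg _).trans hx₀
    have h3 := abs_le.1 hx
    have h4 := le_abs_self (g s x - g₀ x)
    have h5 := abs_nonneg (g s x - g₀ x)
    rw [Real.norm_eq_abs]
    simp only [hG]
    rcases le_total (F s x) (g₀ x) with h6 | h6
    · rw [min_eq_left h6]
      rcases le_total (-g₀ x) (F s x) with h7 | h7
      · rw [max_eq_right h7]; simp
      · rw [max_eq_left h7, abs_le]; constructor <;> linarith
    · rw [min_eq_right h6, max_eq_right (by linarith), abs_le]
      constructor <;> linarith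
  simpa using h2.add h1

theorem integral_map_withDensity_ofReal {y f φ : ℝ → ℝ} (hy : Continuous y)
    (hf : AEMeasurable f) (hf0 : ∀ᵐ x, 0 ≤ f x) (hφ : Continuous φ) :
    ∫ x, φ x ∂((volume.withDensity fun ξ => ENNReal.ofReal (f ξ)).map y)
      = ∫ ξ, f ξ * φ (y ξ) := by
  rw [integral_map hy.measurable.aemeasurable hφ.aestronglyMeasurable,
    integral_withDensity_eq_integral_toReal_smul₀ hf.ennreal_ofReal (by simp)]
  refine integral_congr_ae ?_
  filter_upwards [hf0] with x hx
  simp [ENNReal.toReal_ofReal hx]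

theorem isFiniteMeasure_withDensity_of_le {f h : ℝ → ℝ} (hh : Integrable h)
    (hle : ∀ᵐ x, f x ≤ h x) :
    IsFiniteMeasure (volume.withDensity fun ξ => ENNReal.ofReal (f ξ)) := by
  refine isFiniteMeasure_withDensity (ne_top_of_le_ne_top hh.lintegral_lt_top.ne
    (lintegral_mono_ae ?_))
  filter_upwards [hle] with x hx using ENNReal.ofReal_le_ofReal hx

theorem integral_abs_le_of_eLpNorm_one_le {f : ℝ → ℝ} {C : ℝ} (hC0 : 0 ≤ C) (hf : Integrable f)
    (hC : eLpNorm f 1 volume ≤ ENNReal.ofReal C) : ∫ x, |f x| ≤ C := by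
  have h2 := ofReal_integral_norm_eq_lintegral_enorm hf
  rw [eLpNorm_one_eq_lintegral_enorm, ← h2] at hC
  exact (ENNReal.ofReal_le_ofReal_iff hC0).1 hC

theorem integral_sq_le_of_eLpNorm_two_le {f : ℝ → ℝ} {C : ℝ≥0} (hf : MemLp f 2)
    (hC : eLpNorm f 2 volume ≤ C) : ∫ x, f x ^ 2 ≤ (C : ℝ) ^ 2 := by
  rw [hf.eLpNorm_eq_integral_rpow_norm (by norm_num) (by norm_num)] at hC
  have h0 : 0 ≤ ∫ x, ‖f x‖ ^ (2 : ℝ≥0∞).toReal := integral_nonneg fun x => by positivity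
  have h1 := ENNReal.toReal_mono ENNReal.coe_ne_top hC
  rw [ENNReal.toReal_ofReal (by positivity), ENNReal.coe_toReal] at h1
  have h2 : ∫ x, ‖f x‖ ^ (2 : ℝ≥0∞).toReal = ∫ x, f x ^ 2 :=
    integral_congr_ae (Eventually.of_forall fun x => by simp)
  rw [h2] at h0 h1
  rw [ENNReal.toReal_ofNat, ← one_div, ← Real.sqrt_eq_rpow] at h1
  exact (Real.sqrt_le_left C.2).1 h1

/-! ### Lagrangian solutions: trajectories, left limits of `h̄`, weak-* convergence -/

namespace IsLagrangianSolution

variable {α : ℝ} {Θ : ℝ → LagState}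

/-- `P` is bounded on `[0,T] × ℝ`. -/
theorem exists_abs_P_le (H : IsLagrangianSolution α Θ) (T : ℝ) :
    ∃ C, ∀ t ∈ Icc 0 T, ∀ ξ, |(Θ t).P ξ| ≤ C := by
  obtain ⟨Cu, hCu⟩ := H.U_bdd T
  obtain ⟨Cq, hCq⟩ := (H.q_lip ∞ (by simp)).1 T
  obtain ⟨Ch, hCh⟩ := (H.h_lip 1 (by simp)).1 T
  refine ⟨1 / 4 * (2 * (1 + Cq) * Cu ^ 2 + Ch), fun t ht ξ => ?_⟩
  have M := H.memG t ht.1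
  have hU : Integrable fun η => (Θ t).U η ^ 2 := M.U_mem.1.integrable_sq
  have hU2 := integral_sq_le_of_eLpNorm_two_le M.U_mem.1 (hCu t ht).2
  have hh := integral_abs_le_of_eLpNorm_one_le Ch.2 M.h_int
    ((hCh t ht).2.trans_eq ENNReal.ofReal_coe_nnreal.symm)
  have hq : ∀ᵐ η, (Θ t).q η ≤ 1 + Cq := by
    have h1 := (hCq t ht).2
    rw [eLpNorm_exponent_top] at h1
    filter_upwards [ae_le_eLpNormEssSup (f := fun η => (Θ t).q η - 1) (μ := volume)] with η hη
    have h2 := hη.trans h1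
    rw [enorm_le_coe] at h2
    have h3 : |(Θ t).q η - 1| ≤ Cq := by exact_mod_cast h2
    linarith [le_abs_self ((Θ t).q η - 1)]
  rw [LagState.P, abs_mul, abs_of_pos (by norm_num : (0 : ℝ) < 1 / 4)]
  refine mul_le_mul_of_nonneg_left ?_ (by norm_num)
  have hint : Integrable fun η => 2 * (1 + Cq) * (Θ t).U η ^ 2 + |(Θ t).h η| :=
    (hU.const_mul _).add M.h_int.abs
  rw [← Real.norm_eq_abs]
  refine (norm_integral_le_of_norm_le hint ?_).trans ?_
  · filter_upwards [hq, M.q_nonneg, M.hbar_nonneg, M.hbar_le] with η a1 a2 a3 a4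
    have hn : 0 ≤ 2 * (Θ t).U η ^ 2 * (Θ t).q η + (Θ t).hbar η := by positivity
    rw [norm_mul, Real.norm_of_nonneg (Real.exp_pos _).le, Real.norm_of_nonneg hn]
    have h1 : Real.exp (-|(Θ t).y ξ - (Θ t).y η|) ≤ 1 :=
      Real.exp_le_one_iff.2 (neg_nonpos.2 (abs_nonneg _))
    have h2 := mul_le_mul_of_nonneg_right h1 hn
    have h3 := mul_le_mul_of_nonneg_left a1 (sq_nonneg ((Θ t).U η))
    have h4 := le_abs_self ((Θ t).h η)
    linarith
  · rw [integral_add (hU.const_mul _) M.h_int.abs, integral_const_mul]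
    exact add_le_add (mul_le_mul_of_nonneg_left hU2 (by positivity)) hh

/-- Almost every characteristic is a trajectory; the pointwise relations hold at all times by
right-continuity. -/
theorem ae_isTrajectory (H : IsLagrangianSolution α Θ) :
    ∀ᵐ ξ, IsTrajectory α (fun t => (Θ t).q ξ) (fun t => (Θ t).w ξ) (fun t => (Θ t).h ξ)
      (fun t => (Θ t).hbar ξ) (fun t => (Θ t).U ξ ^ 2 - (Θ t).P ξ) ((Θ 0).r ξ) := by
  -- The exceptional null set of each relation in `𝒢` depends on time. Only countably many times can
  -- be handled at once, and rational ones suffice since they accumulate from the right at every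
  -- time.
  have hrat : ∀ᵐ ξ, ∀ p : ℚ, (0 : ℝ) ≤ p → 0 ≤ (Θ p).q ξ ∧ 0 ≤ (Θ p).hbar ξ ∧
      (Θ p).q ξ * (Θ p).hbar ξ = (Θ p).w ξ ^ 2 + (Θ p).r ξ ^ 2 := by
    refine ae_all_iff.2 fun p => ?_
    by_cases hp : (0 : ℝ) ≤ p
    · filter_upwards [(H.memG p hp).q_nonneg, (H.memG p hp).hbar_nonneg, (H.memG p hp).energy]
        with ξ a1 a2 a3 _
      exact ⟨a1, a2, a3⟩
    · exact Eventually.of_forall fun ξ h => absurd h hp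
  filter_upwards [hrat, H.τ_lim, H.U_ode, H.q_ode, H.w_ode, H.h_ode, H.r_ode, H.hbar_ode,
    H.hbar_jump] with ξ hr hτ hU hq hw hh hr0 hinc hj
  have hb : ∀ t, 0 ≤ t → Tendsto (fun s => (Θ s).hbar ξ) (𝓝[>] t) (𝓝 ((Θ t).hbar ξ)) :=
    fun t ht => tendsto_nhdsGT_of_increments hτ (fun _ h => hh.tendsto_nhdsGT h) hinc ht
  have hfreq : ∀ t : ℝ, ∃ᶠ s in 𝓝[>] t, t < s ∧ s ∈ range ((↑) : ℚ → ℝ) := fun t => by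
    rw [frequently_iff]
    intro V hV
    obtain ⟨b, htb, hV⟩ := mem_nhdsGT_iff_exists_Ioo_subset.1 hV
    obtain ⟨p, hp1, hp2⟩ := exists_rat_btwn (mem_Ioi.1 htb)
    exact ⟨p, hV ⟨hp1, hp2⟩, hp1, p, rfl⟩
  have ext : ∀ (t : ℝ) (F : ℝ → ℝ) (s : Set ℝ), 0 ≤ t → IsClosed s →
      Tendsto F (𝓝[>] t) (𝓝 (F t)) → (∀ p : ℚ, (0 : ℝ) ≤ p → F p ∈ s) → F t ∈ s := by
    intro t F s ht hs hF hp
    refine hs.mem_of_frequently_of_tendsto ((hfreq t).mono ?_) hF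
    rintro _ ⟨h1, p, rfl⟩
    exact hp p (ht.trans h1.le)
  refine ⟨hq, hw, hh, fun t ht => ?_, fun t ht => ?_, fun t ht => ?_, fun T => ?_, hτ, hinc, hj⟩
  · exact ext t _ (Ici 0) ht isClosed_Ici (hq.tendsto_nhdsGT ht) fun p hp => (hr p hp).1
  · exact ext t _ (Ici 0) ht isClosed_Ici (hb t ht) fun p hp => (hr p hp).2.1
  · refine sub_eq_zero.1 (ext t (fun s => (Θ s).q ξ * (Θ s).hbar ξ
      - ((Θ s).w ξ ^ 2 + (Θ 0).r ξ ^ 2)) {0} ht isClosed_singleton ?_ fun p hp => ?_)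
    · exact ((hq.tendsto_nhdsGT ht).mul (hb t ht)).sub
        (((hw.tendsto_nhdsGT ht).pow 2).add tendsto_const_nhds)
    · rw [mem_singleton_iff, sub_eq_zero, (hr p hp).2.2, hr0 p hp]
  · obtain ⟨C, hC⟩ := H.exists_abs_P_le T
    obtain ⟨K, hK⟩ := (isCompact_Icc (a := (0 : ℝ)) (b := T)).exists_bound_of_continuousOn
      (hU.continuousOn.mono fun x hx => hx.1)
    refine ⟨K ^ 2 + C, fun t ht => ?_⟩
    have h1 := hK t ht
    rw [Real.norm_eq_abs] at h1
    have h2 : (Θ t).U ξ ^ 2 ≤ K ^ 2 := sq_le_sq' (neg_le_of_abs_le h1) (le_of_abs_le h1)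
    refine (abs_sub _ _).trans (add_le_add ?_ (hC t ht ξ))
    rwa [abs_of_nonneg (sq_nonneg _)]

/-- The left limit in time of `h̄`. -/
noncomputable def hbarLeft (Θ : ℝ → LagState) (t ξ : ℝ) : ℝ := limUnder (𝓝[<] t) fun s => (Θ s).hbar ξ

/-- The left limit of `h̄` exists and determines `h̄`. -/
theorem ae_hbarLeft (H : IsLagrangianSolution α Θ) :
    ∀ᵐ ξ, ∀ t, 0 < t → Tendsto (fun s => (Θ s).hbar ξ) (𝓝[<] t) (𝓝 (hbarLeft Θ t ξ)) ∧
      (0 < (Θ t).q ξ → (Θ t).hbar ξ = hbarLeft Θ t ξ) ∧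
      ((Θ t).q ξ = 0 → (Θ t).hbar ξ = (1 - α) * hbarLeft Θ t ξ) ∧
      ((∀ n, breakTime (fun t => (Θ t).q ξ) (n + 1) ≠ t) →
        (Θ t).hbar ξ = hbarLeft Θ t ξ ∧ ((Θ t).q ξ = 0 → (Θ t).hbar ξ = 0)) := by
  filter_upwards [H.ae_isTrajectory] with ξ hξ t ht
  obtain ⟨l, hl, h⟩ := hξ.exists_left_limit ht
  have : hbarLeft Θ t ξ = l := hl.limUnder_eq
  rw [this]
  exact ⟨hl, h⟩

theorem aemeasurable_hbarLeft (H : IsLagrangianSolution α Θ) {t : ℝ} (ht : 0 < t) :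
    AEMeasurable (hbarLeft Θ t) := by
  obtain ⟨u, -, hu, hul⟩ := exists_seq_strictMono_tendsto' ht
  have hu' : Tendsto u atTop (𝓝[<] t) :=
    tendsto_nhdsWithin_iff.2 ⟨hul, Eventually.of_forall fun n => (hu n).2⟩
  refine aemeasurable_of_tendsto_metrizable_ae atTop
    (fun n => (H.memG (u n) (hu n).1.le).hbar_meas.aemeasurable) ?_
  filter_upwards [H.ae_hbarLeft] with ξ hξ
  exact (hξ t ht).1.comp hu'

/-- The bound `h̄ ≤ h` is used only along a sequence of times, hence off one null set, and passes to
the limit because `h` is continuous in time. -/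
theorem ae_hbarLeft_mem_Icc (H : IsLagrangianSolution α Θ) {t : ℝ} (ht : 0 < t) :
    ∀ᵐ ξ, 0 ≤ hbarLeft Θ t ξ ∧ hbarLeft Θ t ξ ≤ (Θ t).h ξ := by
  obtain ⟨u, -, hu, hul⟩ := exists_seq_strictMono_tendsto' ht
  have hu' : Tendsto u atTop (𝓝[<] t) :=
    tendsto_nhdsWithin_iff.2 ⟨hul, Eventually.of_forall fun n => (hu n).2⟩
  have h1 : ∀ᵐ ξ, ∀ n, (Θ (u n)).hbar ξ ≤ (Θ (u n)).h ξ :=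
    ae_all_iff.2 fun n => (H.memG (u n) (hu n).1.le).hbar_le
  filter_upwards [H.ae_hbarLeft, H.ae_isTrajectory, h1] with ξ hξ hT hn
  have h2 := (hξ t ht).1.comp hu'
  exact ⟨ge_of_tendsto' h2 fun n => hT.hb_nonneg _ (hu n).1.le,
    le_of_tendsto_of_tendsto' h2 ((hT.h_ode.continuousAt ht).tendsto.comp hul) hn⟩

theorem isFiniteMeasure_withDensity_hbar (H : IsLagrangianSolution α Θ) {t : ℝ} (ht : 0 ≤ t) :
    IsFiniteMeasure (volume.withDensity fun ξ => ENNReal.ofReal ((Θ t).hbar ξ)) :=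
  isFiniteMeasure_withDensity_of_le (H.memG t ht).h_int (H.memG t ht).hbar_le

/-- Convergence of `∫ φ dμ(s)` as `s → t` along a filter on which `h̄` converges pointwise. -/
theorem tendsto_integral_hbar (H : IsLagrangianSolution α Θ) {t : ℝ} (ht : 0 ≤ t) {l : Filter ℝ}
    [l.IsCountablyGenerated] (hl : l ≤ 𝓝 t) (hl0 : ∀ᶠ s in l, 0 ≤ s) {f : ℝ → ℝ}
    (hf : AEMeasurable f) (hfm : ∀ᵐ ξ, 0 ≤ f ξ ∧ f ξ ≤ (Θ t).h ξ)
    (hlim : ∀ᵐ ξ, Tendsto (fun s => (Θ s).hbar ξ) l (𝓝 (f ξ)))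
    {φ : ℝ → ℝ} (hφ : Continuous φ) (hφc : HasCompactSupport φ) :
    Tendsto (fun s => ∫ x, φ x ∂((volume.withDensity fun ξ =>
      ENNReal.ofReal ((Θ s).hbar ξ)).map (Θ s).y)) l
      (𝓝 (∫ x, φ x ∂((volume.withDensity fun ξ => ENNReal.ofReal (f ξ)).map (Θ t).y))) := by
  obtain ⟨M, hM⟩ := hφc.exists_bound_of_continuous hφ
  have hM0 : 0 ≤ M := (norm_nonneg _).trans (hM 0)
  have hyc : ∀ s, 0 ≤ s → Continuous (Θ s).y := fun s hs => (H.memG s hs).y_deriv.continuous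
  rw [integral_map_withDensity_ofReal (hyc t ht) hf (hfm.mono fun _ h => h.1) hφ]
  have hmain : Tendsto (fun s => ∫ ξ, (Θ s).hbar ξ * φ ((Θ s).y ξ)) l
      (𝓝 (∫ ξ, f ξ * φ ((Θ t).y ξ))) := by
    -- The majorant `h(s) M` converges in `L¹` because `h` is Lipschitz in time with values in `L¹`.
    refine tendsto_integral_of_le_of_tendsto (g := fun s ξ => (Θ s).h ξ * M)
      (g₀ := fun ξ => (Θ t).h ξ * M) ?_ ?_ ?_ ((H.memG t ht).h_int.mul_const M) ?_ ?_ ?_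
    · filter_upwards [hl0] with s hs
      exact (H.memG s hs).hbar_meas.mul (hφ.comp (hyc s hs)).aestronglyMeasurable
    · filter_upwards [hl0] with s hs
      filter_upwards [(H.memG s hs).hbar_nonneg, (H.memG s hs).hbar_le] with ξ h0 h1
      rw [abs_mul, abs_of_nonneg h0]
      exact mul_le_mul h1 (hM _) (abs_nonneg _) (h0.trans h1)
    · filter_upwards [hl0] with s hs using (H.memG s hs).h_int.mul_const M
    · obtain ⟨C, hC⟩ := (H.h_lip 1 (by simp)).2 (t + 1)
      have h1 : Tendsto (fun s : ℝ => C * |s - t| * M) l (𝓝 0) := by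
        have : Continuous fun s : ℝ => C * |s - t| * M := by fun_prop
        have h2 := (this.tendsto t).mono_left hl
        simpa using h2
      refine squeeze_zero' (Eventually.of_forall fun s => integral_nonneg fun ξ => abs_nonneg _)
        ?_ h1
      filter_upwards [hl0, hl (Iio_mem_nhds (show t < t + 1 by linarith))] with s hs hs1
      have h3 := hC t ⟨ht, by linarith⟩ s ⟨hs, le_of_lt hs1⟩
      have h4 : (fun ξ => |(Θ s).h ξ * M - (Θ t).h ξ * M|)
          = fun ξ => |((Θ s).h - (Θ t).h) ξ| * M := by
        funext ξ
        rw [← sub_mul, abs_mul, abs_of_nonneg hM0, Pi.sub_apply]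
      rw [h4, integral_mul_const]
      refine mul_le_mul_of_nonneg_right ?_ hM0
      refine integral_abs_le_of_eLpNorm_one_le (by positivity)
        ((H.memG s hs).h_int.sub (H.memG t ht).h_int) ?_
      rw [ENNReal.ofReal_mul (NNReal.coe_nonneg C), ENNReal.ofReal_coe_nnreal]
      exact h3
    · filter_upwards [hfm] with ξ hξ
      rw [abs_mul, abs_of_nonneg hξ.1]
      exact mul_le_mul hξ.2 (hM _) (abs_nonneg _) (hξ.1.trans hξ.2)
    · filter_upwards [hlim, H.y_ode] with ξ h1 h2
      refine h1.mul ((hφ.tendsto _).comp ((h2.continuousOn t ht).mono_left ?_))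
      exact le_inf hl (le_principal_iff.2 hl0)
  refine hmain.congr' ?_
  filter_upwards [hl0] with s hs
  exact (integral_map_withDensity_ofReal (hyc s hs) (H.memG s hs).hbar_meas.aemeasurable
    (H.memG s hs).hbar_nonneg hφ).symm

/-- Almost every time is not a breaking time of almost every characteristic. -/
theorem ae_ae_breakTime_ne (H : IsLagrangianSolution α Θ) :
    ∀ᵐ t : ℝ, ∀ᵐ ξ, ∀ n, breakTime (fun t => (Θ t).q ξ) (n + 1) ≠ t := by
  have key : ∀ n, ∀ᵐ t : ℝ, ∀ᵐ ξ, breakTime (fun t => (Θ t).q ξ) (n + 1) ≠ t := by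
    intro n
    have hm := (H.τ_meas (n + 1)).measurable_mk
    -- A measurable representative makes the set of pairs `(ξ, t)` with `τ_{n+1}(ξ) ≠ t` measurable,
    -- so that Fubini applies; for fixed `ξ` at most one `t` is excluded.
    set g := (H.τ_meas (n + 1)).mk with hg
    have hset : MeasurableSet {p : ℝ × ℝ | g p.1 ≠ (p.2 : EReal)} :=
      (measurableSet_eq_fun (hm.comp measurable_fst)
        (measurable_coe_real_ereal.comp measurable_snd)).compl
    have h1 : ∀ᵐ ξ : ℝ, ∀ᵐ t : ℝ, g ξ ≠ (t : EReal) := by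
      refine Eventually.of_forall fun ξ => ?_
      have hss : {t : ℝ | ¬ g ξ ≠ (t : EReal)} ⊆ {(g ξ).toReal} := by
        intro t ht
        have ht : g ξ = (t : EReal) := not_not.1 ht
        rw [mem_singleton_iff, ht, EReal.toReal_coe]
      exact measure_mono_null hss (by simp)
    filter_upwards [(Measure.ae_ae_comm hset).1 h1] with t ht
    filter_upwards [ht, (H.τ_meas (n + 1)).ae_eq_mk] with ξ h2 h3
    rw [h3]
    exact h2
  filter_upwards [ae_all_iff.2 key] with t ht
  exact ae_all_iff.2 ht

end IsLagrangianSolution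

/-! ### Lebesgue decomposition of `μ(t)` and of its left limit -/

theorem acPart_add_singPart (m : Measure ℝ) [IsFiniteMeasure m] : acPart m + singPart m = m :=
  Measure.rnDeriv_add_singularPart m volume

namespace IsLagrangianSolution

variable {α : ℝ} {Θ : ℝ → LagState}

/-- The push-forward of the left limit of `h̄`, which is the left limit of the measures `μ`. -/
noncomputable def leftMeasure (Θ : ℝ → LagState) (t : ℝ) : Measure ℝ :=
  (volume.withDensity fun ξ => ENNReal.ofReal (hbarLeft Θ t ξ)).map (Θ t).y

theorem isFiniteMeasure_withDensity_hbarLeft (H : IsLagrangianSolution α Θ) {t : ℝ} (ht : 0 < t) :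
    IsFiniteMeasure (volume.withDensity fun ξ => ENNReal.ofReal (hbarLeft Θ t ξ)) :=
  isFiniteMeasure_withDensity_of_le (H.memG t ht.le).h_int
    ((H.ae_hbarLeft_mem_Icc ht).mono fun _ h => h.2)

/-- The points of positive derivative of `y` are those where `y_ξ > 0`, the others those where
`y_ξ = 0`, up to null sets. -/
theorem ae_posDerivSet (H : IsLagrangianSolution α Θ) {t : ℝ} (ht : 0 ≤ t) :
    ∀ᵐ ξ, (ξ ∈ posDerivSet (Θ t).y → 0 < (Θ t).q ξ) ∧
      (ξ ∈ (posDerivSet (Θ t).y)ᶜ → (Θ t).q ξ = 0) := by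
  filter_upwards [(H.memG t ht).y_deriv.ae_mem_posDerivSet_iff, (H.memG t ht).q_nonneg]
    with ξ h1 h2
  exact ⟨h1.1, fun h => le_antisymm (not_lt.1 fun h3 => h (h1.2 h3)) h2⟩

/-- Both measures are push-forwards under the same `y(t)`, so they split along the same set
`posDerivSet`. There `h̄` is its left limit, and on the complement it is `1 - α` times it. -/
theorem acPart_singPart_hbar (H : IsLagrangianSolution α Θ) (hα : α ≤ 1) {t : ℝ} (ht : 0 < t) :
    acPart ((volume.withDensity fun ξ => ENNReal.ofReal ((Θ t).hbar ξ)).map (Θ t).y)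
        = acPart (leftMeasure Θ t) ∧
      singPart ((volume.withDensity fun ξ => ENNReal.ofReal ((Θ t).hbar ξ)).map (Θ t).y)
        = ENNReal.ofReal (1 - α) • singPart (leftMeasure Θ t) := by
  have M := H.memG t ht.le
  have := H.isFiniteMeasure_withDensity_hbar ht.le
  have := H.isFiniteMeasure_withDensity_hbarLeft ht
  have hP := measurableSet_posDerivSet (Θ t).y
  obtain ⟨a1, s1⟩ := acPart_singPart_map M.y_deriv M.q_nonneg
    (m := volume.withDensity fun ξ => ENNReal.ofReal ((Θ t).hbar ξ))
    (withDensity_absolutelyContinuous _ _)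
  obtain ⟨a2, s2⟩ := acPart_singPart_map M.y_deriv M.q_nonneg
    (m := volume.withDensity fun ξ => ENNReal.ofReal (hbarLeft Θ t ξ))
    (withDensity_absolutelyContinuous _ _)
  rw [leftMeasure, a1, a2, s1, s2]
  constructor
  · congr 1
    rw [restrict_withDensity hP, restrict_withDensity hP]
    refine withDensity_congr_ae ((ae_restrict_iff' hP).2 ?_)
    filter_upwards [H.ae_posDerivSet ht.le, H.ae_hbarLeft] with ξ h1 h2 h3
    rw [(h2 t ht).2.1 (h1.1 h3)]
  · rw [← Measure.map_smul]
    congr 1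
    rw [restrict_withDensity hP.compl, restrict_withDensity hP.compl,
      ← withDensity_smul' _ _ ENNReal.ofReal_ne_top]
    refine withDensity_congr_ae ((ae_restrict_iff' hP.compl).2 ?_)
    filter_upwards [H.ae_posDerivSet ht.le, H.ae_hbarLeft] with ξ h1 h2 h3
    rw [(h2 t ht).2.2.1 (h1.2 h3), ENNReal.ofReal_mul (by linarith)]
    rfl

/-- At times that are not breaking times of a.e. characteristic, `μ` is left-continuous and
absolutely continuous. -/
theorem eq_leftMeasure_of_ae_breakTime_ne (H : IsLagrangianSolution α Θ) {t : ℝ} (ht : 0 < t)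
    (hne : ∀ᵐ ξ, ∀ n, breakTime (fun t => (Θ t).q ξ) (n + 1) ≠ t) :
    leftMeasure Θ t = (volume.withDensity fun ξ => ENNReal.ofReal ((Θ t).hbar ξ)).map (Θ t).y ∧
      singPart ((volume.withDensity fun ξ => ENNReal.ofReal ((Θ t).hbar ξ)).map (Θ t).y) = 0 := by
  have M := H.memG t ht.le
  have := H.isFiniteMeasure_withDensity_hbar ht.le
  constructor
  · rw [leftMeasure]
    congr 1
    refine withDensity_congr_ae ?_
    filter_upwards [H.ae_hbarLeft, hne] with ξ h1 h2
    rw [((h1 t ht).2.2.2 h2).1]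
  · have hP := measurableSet_posDerivSet (Θ t).y
    rw [(acPart_singPart_map M.y_deriv M.q_nonneg
      (m := volume.withDensity fun ξ => ENNReal.ofReal ((Θ t).hbar ξ))
      (withDensity_absolutelyContinuous _ _)).2, restrict_withDensity hP.compl,
      withDensity_congr_ae (g := 0), withDensity_zero, Measure.map_zero]
    refine (ae_restrict_iff' hP.compl).2 ?_
    filter_upwards [H.ae_posDerivSet ht.le, H.ae_hbarLeft, hne] with ξ h1 h2 h3 h4
    rw [((h2 t ht).2.2.2 h3).2 (h1.2 h4), ENNReal.ofReal_zero]
    rfl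

end IsLagrangianSolution

theorem theorem4p3 (α : ℝ) (hα : α ∈ Set.Icc (0 : ℝ) 1) (S₀ : EulerState) (hS₀ : S₀.MemD)
    (S : ℝ → EulerState) (hS : IsAlphaDissipativeSolution α S₀ S) :
    (∀ t, 0 ≤ t → IsFiniteMeasure (S t).μ) ∧
    ∃ μm μp : ℝ → Measure ℝ,
      (∀ t, 0 < t → IsFiniteMeasure (μm t) ∧
        WeakStarTendsto (fun s => (S s).μ) (𝓝[<] t) (μm t)) ∧
      (∀ t, 0 ≤ t → IsFiniteMeasure (μp t) ∧
        WeakStarTendsto (fun s => (S s).μ) (𝓝[>] t) (μp t)) ∧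
      (∀ t, 0 ≤ t → μp t = (S t).μ) ∧
      (∀ t, 0 < t → (S t).μ = acPart (μm t) + ENNReal.ofReal (1 - α) • singPart (μm t)) ∧
      (∀ t, 0 < t → acPart (S t).μ = acPart (μm t) ∧
        singPart (S t).μ = ENNReal.ofReal (1 - α) • singPart (μm t)) ∧
      (∀ᵐ t ∂(volume.restrict (Set.Ioi (0 : ℝ))),
        μp t = μm t ∧ μm t = (S t).μ ∧ (S t).μ = acPart (S t).μ) := by
  obtain ⟨Θ, H, -, hE⟩ := hS
  have hμ : ∀ t, 0 ≤ t → (S t).μ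
      = (volume.withDensity fun ξ => ENNReal.ofReal ((Θ t).hbar ξ)).map (Θ t).y :=
    fun t ht => (hE t ht).μ
  have hfin : ∀ t, 0 ≤ t → IsFiniteMeasure (S t).μ := fun t ht => by
    have := H.isFiniteMeasure_withDensity_hbar ht
    rw [hμ t ht]
    infer_instance
  have hlim : ∀ (t : ℝ) (l : Filter ℝ) (f : ℝ → ℝ), 0 ≤ t → l.IsCountablyGenerated → l ≤ 𝓝 t →
      (∀ᶠ s in l, 0 ≤ s) → AEMeasurable f → (∀ᵐ ξ, 0 ≤ f ξ ∧ f ξ ≤ (Θ t).h ξ) →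
      (∀ᵐ ξ, Tendsto (fun s => (Θ s).hbar ξ) l (𝓝 (f ξ))) →
      WeakStarTendsto (fun s => (S s).μ) l
        ((volume.withDensity fun ξ => ENNReal.ofReal (f ξ)).map (Θ t).y) := by
    intro t l f ht _ hl hl0 hf hfm hfl φ hφ hφc
    refine (H.tendsto_integral_hbar ht hl hl0 hf hfm hfl hφ hφc).congr' ?_
    filter_upwards [hl0] with s hs
    rw [hμ s hs]
  have hdec : ∀ t, 0 < t → acPart (S t).μ = acPart (IsLagrangianSolution.leftMeasure Θ t) ∧
      singPart (S t).μ = ENNReal.ofReal (1 - α) • singPart (IsLagrangianSolution.leftMeasure Θ t) := fun t ht => by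
    rw [hμ t ht.le]
    exact H.acPart_singPart_hbar hα.2 ht
  refine ⟨hfin, IsLagrangianSolution.leftMeasure Θ, fun t => (S t).μ, fun t ht => ⟨?_, ?_⟩,
    fun t ht => ⟨hfin t ht, ?_⟩, fun _ _ => rfl, fun t ht => ?_, hdec, ?_⟩
  · have := H.isFiniteMeasure_withDensity_hbarLeft ht
    unfold IsLagrangianSolution.leftMeasure
    infer_instance
  · refine hlim t _ _ ht.le inferInstance nhdsWithin_le_nhds ?_ (H.aemeasurable_hbarLeft ht)
      (H.ae_hbarLeft_mem_Icc ht) (H.ae_hbarLeft.mono fun ξ h => (h t ht).1)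
    filter_upwards [Ioo_mem_nhdsLT ht] with s hs using hs.1.le
  · have M := H.memG t ht
    have := hlim t (𝓝[>] t) (Θ t).hbar ht inferInstance nhdsWithin_le_nhds ?_
      M.hbar_meas.aemeasurable (M.hbar_nonneg.and M.hbar_le)
      (H.ae_isTrajectory.mono fun ξ h => h.tendsto_hb_nhdsGT ht)
    · rwa [← hμ t ht] at this
    · filter_upwards [self_mem_nhdsWithin] with s hs using ht.trans (le_of_lt hs)
  · have := hfin t ht.le
    rw [← (hdec t ht).1, ← (hdec t ht).2, acPart_add_singPart]
  · refine (ae_restrict_iff' measurableSet_Ioi).2 ?_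
    filter_upwards [H.ae_ae_breakTime_ne] with t hne ht
    have := hfin t (le_of_lt ht)
    obtain ⟨h1, h2⟩ := H.eq_leftMeasure_of_ae_breakTime_ne ht hne
    rw [← hμ t (le_of_lt ht)] at h1 h2
    refine ⟨h1.symm, h1, ?_⟩
    conv_lhs => rw [← acPart_add_singPart (S t).μ, h2, add_zero]
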